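/- Conventions. An effect algebra is a partial commutative monoid $(A,\oplus,0)$ with an operation $(-)^\perp\colon A\to A$ such that, writing $1=0^\perp$, $x^\perp$ is the unique $y$ with $x\oplus y=1$, and $x\oplus 1$ is defined if and only if $x=0$. Morphisms preserve $0$, $(-)^\perp$ and $\oplus$ (whenever $a\oplus b$ is defined, so is $f(a)\oplus f(b)$, and it equals $f(a\oplus b)$); this gives the category $\mathbf{EA}$. A Boolean algebra is an effect algebra with $a\oplus b=a\vee b$, defined iff $a\wedge b=0$, and $a^\perp=\neg a$; the interval $[0,1]$ is an effect algebra with $r\oplus s=r+s$, defined iff $r+s\le 1$, and $r^\perp=1-r$. A bilinear morphism $A\times B\to C$ is a map that preserves $0$ and $\oplus$ in each variable separately and sends $(1,1)$ to $1$; the tensor product $A\otimes B$ is the effect algebra representing bilinear morphisms out of $A\times B$. An effect module is an effect algebra $E$ with a bilinear morphism $[0,1]\times E\to E$, $(r,x)\mapsto rx$, such that $1x=x$ and $(rs)x=r(sx)$; effect modules and the effect algebra morphisms preserving the action form the category $\mathbf{EMod}$. The forgetful functor $\mathbf{EMod}\to\mathbf{EA}$ has the left adjoint $A\mapsto[0,1]\otimes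 A$ with unit $a\mapsto 1\otimes a$; let $\mathcal M$ be the induced monad on $\mathbf{EA}$, with $\mathcal M A=[0,1]\otimes A$. Let $\mathbf{Kl}_{\mathbf{BA}_{\mathsf f}}(\mathcal M)$ be the full subcategory of the Kleisli category of $\mathcal M$ on the finite Boolean algebras, and let $$I_{\mathcal M}\colon \mathbf{Kl}_{\mathbf{BA}_{\mathsf f}}(\mathcal M)\to\mathbf{EMod}$$ be the canonical functor sending $B$ to the effect module $[0,1]\otimes B$ and a Kleisli morphism $f\colon B\to[0,1]\otimes B'$ to its unique extension to an effect module morphism $[0,1]\otimes B\to[0,1]\otimes B'$. Proposition. The functor $I_{\mathcal M}$ is full and faithful; for every finite set $X$ there is an isomorphism of effect modules $I_{\mathcal M}(2^X)\cong[0,1]^X$ (with pointwise structure on $[0,1]^X$) sending $1\otimes S$ to the characteristic function $\chi_S$ for each $S\subseteq X$; and $I_{\mathcal M}$ is dense, that is, every effect module $E$ is the colimit of the canonical diagram of all morphisms $I_{\mathcal M}(B)\to E$, with $B$ in $\mathbf{Kl}_{\mathbf{BA}_{\mathsf f}}(\mathcal M)$, with these morphisms as colimit cocone. -/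

import Mathlib

open CategoryTheory

universe u v w

/-! ### Effect algebras -/

/-- An effect algebra: a partial commutative monoid `(A, ⊕, 0)`, where `⊕` is a partial binary
operation (the commutative and associative laws are Kleene equalities: one side is defined iff the
other one is, and then they agree), with an orthocomplement `(-)ᗮ` such that, for `1 := 0ᗮ`,
the element `xᗮ` is the unique `y` with `x ⊕ y = 1`, and `x ⊕ 1` is defined iff `x = 0`. -/
class EffectAlgebra (A : Type u) where
  zero : A
  oplus : A → A → Part A
  compl : A → A
  zero_oplus : ∀ a, oplus zero a = Part.some a
  oplus_comm : ∀ a b, oplus a b = oplus b a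
  oplus_assoc : ∀ a b c,
    ((oplus a b).bind fun d => oplus d c) = ((oplus b c).bind fun e => oplus a e)
  oplus_eq_one_iff : ∀ a b, oplus a b = Part.some (compl zero) ↔ b = compl a
  oplus_one_dom_iff : ∀ a, (oplus a (compl zero)).Dom ↔ a = zero

namespace EffectAlgebra

/-- The unit `1 = 0ᗮ`. -/
def one {A : Type u} [EffectAlgebra A] : A := compl zero

section lemmas

variable {A : Type u} [EffectAlgebra A] {B : Type v} [EffectAlgebra B]

theorem mem_comm {a b c : A} (h : c ∈ oplus a b) : c ∈ oplus b a := by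
  rwa [oplus_comm]

theorem mem_zero (a : A) : a ∈ oplus zero a := by
  rw [zero_oplus]; exact Part.mem_some a

theorem eq_of_mem_zero {a b : A} (h : b ∈ oplus zero a) : b = a :=
  Part.mem_unique h (mem_zero a)

theorem mem_assoc {a b c d e : A} (hd : d ∈ oplus a b) (he : e ∈ oplus d c) :
    ∃ f, f ∈ oplus b c ∧ e ∈ oplus a f := by
  have : e ∈ (oplus a b).bind fun d => oplus d c := Part.mem_bind_iff.2 ⟨d, hd, he⟩
  rw [oplus_assoc] at this
  exact Part.mem_bind_iff.1 this

theorem mem_assoc' {a b c e f : A} (hf : f ∈ oplus b c) (he : e ∈ oplus a f) :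
    ∃ d, d ∈ oplus a b ∧ e ∈ oplus d c := by
  have : e ∈ (oplus b c).bind fun f => oplus a f := Part.mem_bind_iff.2 ⟨f, hf, he⟩
  rw [← oplus_assoc] at this
  exact Part.mem_bind_iff.1 this

theorem one_mem_iff {a b : A} : one ∈ oplus a b ↔ b = compl a := by
  rw [← oplus_eq_one_iff, Part.eq_some_iff]; rfl

theorem one_mem (a : A) : one ∈ oplus a (compl a) := one_mem_iff.2 rfl

theorem cancel {a b b' c : A} (h : c ∈ oplus a b) (h' : c ∈ oplus a b') : b = b' := by
  obtain ⟨f, hf, hf1⟩ := mem_assoc (mem_comm h) (one_mem c)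
  obtain ⟨f', hf', hf1'⟩ := mem_assoc (mem_comm h') (one_mem c)
  obtain rfl := Part.mem_unique hf hf'
  rw [one_mem_iff.1 (mem_comm hf1), one_mem_iff.1 (mem_comm hf1')]

theorem eq_zero_of_mem_left {a c : A} (h : c ∈ oplus a c) : a = zero :=
  cancel (mem_comm h) (mem_comm (mem_zero c))

theorem eq_zero_of_mem_zero {a b : A} (h : zero ∈ oplus a b) : a = zero := by
  have hb : b = zero := by
    obtain ⟨f, hf, -⟩ := mem_assoc h (mem_zero (one : A))
    exact (oplus_one_dom_iff b).1 hf.1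
  subst hb
  exact (eq_of_mem_zero (mem_comm h)).symm

theorem mem_exchange {p₁ p₂ q₁ q₂ p q z z₁ z₂ : A} (hp : p ∈ oplus p₁ p₂) (hq : q ∈ oplus q₁ q₂)
    (h₁ : z₁ ∈ oplus p₁ q₁) (h₂ : z₂ ∈ oplus p₂ q₂) (hz : z ∈ oplus p q) :
    z ∈ oplus z₁ z₂ := by
  obtain ⟨s, hs, hzs⟩ := mem_assoc hp hz
  obtain ⟨t, ht, hst⟩ := mem_assoc' hq hs
  obtain ⟨t', ht', hst'⟩ := mem_assoc (mem_comm ht) hst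
  obtain rfl := Part.mem_unique ht' h₂
  obtain ⟨t'', h1', hz'⟩ := mem_assoc' hst' hzs
  obtain rfl := Part.mem_unique h1' h₁
  exact hz'

theorem dom_mono {p p' c q q' d : A} (hp : c ∈ oplus p p') (hq : d ∈ oplus q q')
    (h : (oplus c d).Dom) : (oplus p q).Dom := by
  obtain ⟨z, hz⟩ := Part.dom_iff_mem.1 h
  obtain ⟨s, hs, -⟩ := mem_assoc (mem_comm hp) hz
  obtain ⟨t, ht, -⟩ := mem_assoc' hq hs
  exact Part.dom_iff_mem.2 ⟨t, ht⟩

end lemmas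

/-- A morphism of effect algebras preserves `0`, the orthocomplement (hence also `1`), and `⊕`
(if `a ⊕ b` is defined and equal to `c`, then `f a ⊕ f b` is defined and equal to `f c`). -/
@[ext]
structure Hom (A : Type u) (B : Type v) [EffectAlgebra A] [EffectAlgebra B] where
  toFun : A → B
  map_zero : toFun zero = zero
  map_compl : ∀ a, toFun (compl a) = compl (toFun a)
  map_oplus : ∀ a b c, c ∈ oplus a b → toFun c ∈ oplus (toFun a) (toFun b)

theorem Hom.map_one {A : Type u} {B : Type v} [EffectAlgebra A] [EffectAlgebra B] (f : Hom A B) :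
    f.toFun one = one := by
  unfold one; rw [f.map_compl, f.map_zero]

/-- A bilinear morphism `A × B → C` of effect algebras: it is a morphism of partial commutative
monoids in each variable, and maps `(1, 1)` to `1`. -/
@[ext]
structure Bimorphism (A : Type u) (B : Type v) (C : Type w)
    [EffectAlgebra A] [EffectAlgebra B] [EffectAlgebra C] where
  toFun : A → B → C
  zero_left : ∀ b, toFun zero b = zero
  zero_right : ∀ a, toFun a zero = zero
  oplus_left : ∀ a a' a'' b, a'' ∈ oplus a a' →
    toFun a'' b ∈ oplus (toFun a b) (toFun a' b)
  oplus_right : ∀ a b b' b'', b'' ∈ oplus b b' →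
    toFun a b'' ∈ oplus (toFun a b) (toFun a b')
  one_one : toFun one one = one

/-- The partial binary operation with graph `R`. -/
noncomputable def relPart {A : Type u} (R : A → A → A → Prop) (a b : A) : Part A :=
  ⟨∃ c, R a b c, fun h => h.choose⟩

theorem mem_relPart {A : Type u} {R : A → A → A → Prop}
    (uniq : ∀ a b c c', R a b c → R a b c' → c = c') {a b c : A} :
    c ∈ relPart R a b ↔ R a b c := by
  constructor
  · rintro ⟨h, rfl⟩; exact h.choose_spec
  · intro h; exact ⟨⟨c, h⟩, uniq _ _ _ _ (Exists.choose_spec (⟨c, h⟩ : ∃ c, R a b c)) h⟩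

/-- An effect algebra presented by the graph `R a b c` of its partial operation, that is, by the
relation "`a ⊕ b` is defined and equal to `c`". -/
@[reducible] noncomputable def ofRel {A : Type u} (zero : A) (compl : A → A) (R : A → A → A → Prop)
    (uniq : ∀ a b c c', R a b c → R a b c' → c = c')
    (zero_add : ∀ a, R zero a a)
    (comm : ∀ a b c, R a b c → R b a c)
    (assoc : ∀ a b c d e, R a b d → R d c e → ∃ f, R b c f ∧ R a f e)
    (compl_iff : ∀ a b, R a b (compl zero) ↔ b = compl a)
    (one : ∀ a c, R a (compl zero) c → a = zero) : EffectAlgebra A where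
  zero := zero
  compl := compl
  oplus := relPart R
  zero_oplus a := by
    rw [Part.eq_some_iff, mem_relPart uniq]; exact zero_add a
  oplus_comm a b := by
    ext c; rw [mem_relPart uniq, mem_relPart uniq]; exact ⟨comm _ _ _, comm _ _ _⟩
  oplus_assoc a b c := by
    ext e
    simp only [Part.mem_bind_iff, mem_relPart uniq]
    constructor
    · rintro ⟨d, h1, h2⟩
      exact assoc _ _ _ _ _ h1 h2
    · rintro ⟨f, h1, h2⟩
      obtain ⟨d, h3, h4⟩ := assoc _ _ _ _ _ (comm _ _ _ h1) (comm _ _ _ h2)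
      exact ⟨d, comm _ _ _ h3, comm _ _ _ h4⟩
  oplus_eq_one_iff a b := by
    rw [Part.eq_some_iff, mem_relPart uniq]; exact compl_iff a b
  oplus_one_dom_iff a := by
    constructor
    · rintro ⟨c, h⟩; exact one a c h
    · rintro rfl; exact ⟨_, zero_add _⟩

/-- A Boolean algebra as an effect algebra: `a ⊕ b = a ⊔ b`, defined iff `a ⊓ b = ⊥`, and
`aᗮ = aᶜ`. -/
@[reducible] def ofBooleanAlgebra (B : Type u) [BooleanAlgebra B] : EffectAlgebra B where
  zero := ⊥
  oplus a b := ⟨a ⊓ b = ⊥, fun _ => a ⊔ b⟩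
  compl a := aᶜ
  zero_oplus a := by
    rw [Part.eq_some_iff]; exact ⟨bot_inf_eq a, bot_sup_eq a⟩
  oplus_comm a b := by
    refine Part.ext' ?_ ?_
    · simp [inf_comm]
    · intro _ _; exact sup_comm a b
  oplus_assoc a b c := by
    ext e
    simp only [Part.mem_bind_iff]
    constructor
    · rintro ⟨d, ⟨h1, rfl⟩, ⟨h2, rfl⟩⟩
      simp only [inf_sup_right, sup_eq_bot_iff] at h2
      exact ⟨b ⊔ c, ⟨h2.2, rfl⟩, ⟨by simp only [inf_sup_left, sup_eq_bot_iff]; exact ⟨h1, h2.1⟩,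
        (sup_assoc a b c).symm⟩⟩
    · rintro ⟨d, ⟨h1, rfl⟩, ⟨h2, rfl⟩⟩
      simp only [inf_sup_left, sup_eq_bot_iff] at h2
      exact ⟨a ⊔ b, ⟨h2.1, rfl⟩, ⟨by simp only [inf_sup_right, sup_eq_bot_iff]; exact ⟨h2.2, h1⟩,
        sup_assoc a b c⟩⟩
  oplus_eq_one_iff a b := by
    rw [Part.eq_some_iff, compl_bot]
    constructor
    · rintro ⟨h1, h2⟩
      exact (IsCompl.of_eq h1 h2).compl_eq.symm
    · rintro rfl
      exact ⟨inf_compl_eq_bot, sup_compl_eq_top⟩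
  oplus_one_dom_iff a := by simp

/-- The unit interval as an effect algebra: `r ⊕ s = r + s`, defined iff `r + s ≤ 1`, and
`rᗮ = 1 - r`. -/
instance instUnitInterval : EffectAlgebra unitInterval where
  zero := 0
  oplus r s := ⟨(r : ℝ) + s ≤ 1, fun h => ⟨r + s, add_nonneg r.2.1 s.2.1, h⟩⟩
  compl r := unitInterval.symm r
  zero_oplus r := by
    rw [Part.eq_some_iff]
    exact ⟨by simpa using r.2.2, Subtype.ext (by simp)⟩
  oplus_comm r s := by
    refine Part.ext' ?_ ?_
    · simp [add_comm]
    · intro _ _; exact Subtype.ext (add_comm _ _)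
  oplus_assoc r s t := by
    have hr := r.2.1
    have ht := t.2.1
    ext e
    simp only [Part.mem_bind_iff]
    constructor
    · rintro ⟨d, ⟨h1, rfl⟩, ⟨h2, rfl⟩⟩
      change (r : ℝ) + s + t ≤ 1 at h2
      exact ⟨_, ⟨by change (s : ℝ) + t ≤ 1; linarith, rfl⟩,
        ⟨by change (r : ℝ) + (s + t) ≤ 1; linarith, Subtype.ext (add_assoc _ _ _).symm⟩⟩
    · rintro ⟨d, ⟨h1, rfl⟩, ⟨h2, rfl⟩⟩
      change (r : ℝ) + (s + t) ≤ 1 at h2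
      exact ⟨_, ⟨by change (r : ℝ) + s ≤ 1; linarith, rfl⟩,
        ⟨by change (r : ℝ) + s + t ≤ 1; linarith, Subtype.ext (add_assoc _ _ _)⟩⟩
  oplus_eq_one_iff r s := by
    rw [Part.eq_some_iff]
    constructor
    · rintro ⟨h1, h2⟩
      have h3 : (r : ℝ) + s = 1 := by simpa using congrArg Subtype.val h2
      exact Subtype.ext (by rw [unitInterval.coe_symm_eq]; linarith)
    · rintro rfl
      exact ⟨by simp, Subtype.ext (by simp)⟩
  oplus_one_dom_iff r := by
    have hr := r.2.1
    constructor
    · intro h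
      have h' : (r : ℝ) + (unitInterval.symm 0 : unitInterval) ≤ 1 := h
      simp only [unitInterval.symm_zero, Set.Icc.coe_one] at h'
      exact Subtype.ext (by change (r : ℝ) = 0; linarith)
    · rintro rfl
      change ((0 : unitInterval) : ℝ) + (unitInterval.symm 0 : unitInterval) ≤ 1
      simp

/-- Powers `A ^ X` of an effect algebra, with the pointwise structure. -/
instance instPi (X : Type v) (A : Type u) [EffectAlgebra A] : EffectAlgebra (X → A) where
  zero _ := zero
  oplus f g := ⟨∀ x, (oplus (f x) (g x)).Dom, fun h x => (oplus (f x) (g x)).get (h x)⟩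
  compl f x := compl (f x)
  zero_oplus f := by
    rw [Part.eq_some_iff]
    exact ⟨fun x => (mem_zero (f x)).1, funext fun x => (mem_zero (f x)).2⟩
  oplus_comm f g := by
    ext e
    constructor
    · rintro ⟨h, rfl⟩
      exact ⟨fun x => (mem_comm ⟨h x, rfl⟩).1, funext fun x => (mem_comm ⟨h x, rfl⟩).2⟩
    · rintro ⟨h, rfl⟩
      exact ⟨fun x => (mem_comm ⟨h x, rfl⟩).1, funext fun x => (mem_comm ⟨h x, rfl⟩).2⟩
  oplus_assoc f g k := by
    ext e
    simp only [Part.mem_bind_iff]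
    constructor
    · rintro ⟨d, ⟨h1, rfl⟩, ⟨h2, rfl⟩⟩
      choose a ha ha' using fun x => mem_assoc ⟨h1 x, rfl⟩ ⟨h2 x, rfl⟩
      exact ⟨a, ⟨fun x => (ha x).1, funext fun x => (ha x).2⟩,
        ⟨fun x => (ha' x).1, funext fun x => (ha' x).2⟩⟩
    · rintro ⟨d, ⟨h1, rfl⟩, ⟨h2, rfl⟩⟩
      choose a ha ha' using fun x => mem_assoc' ⟨h1 x, rfl⟩ ⟨h2 x, rfl⟩
      exact ⟨a, ⟨fun x => (ha x).1, funext fun x => (ha x).2⟩,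
        ⟨fun x => (ha' x).1, funext fun x => (ha' x).2⟩⟩
  oplus_eq_one_iff f g := by
    rw [Part.eq_some_iff]
    constructor
    · rintro ⟨h1, h2⟩
      exact funext fun x => one_mem_iff.1 ⟨h1 x, congrFun h2 x⟩
    · rintro rfl
      exact ⟨fun x => (one_mem (f x)).1, funext fun x => (one_mem (f x)).2⟩
  oplus_one_dom_iff f := by
    constructor
    · intro h
      exact funext fun x => (oplus_one_dom_iff (f x)).1 (h x)
    · rintro rfl x
      exact (oplus_one_dom_iff _).2 rfl

/-- The interval `[0, c]` in an effect algebra `A`. -/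
def Interval {A : Type u} [EffectAlgebra A] (c : A) : Type u := {x : A // ∃ y, c ∈ oplus x y}

/-- The interval `[0, c]` is an effect algebra with `⊕` restricted to those sums that
lie below `c`. -/
noncomputable instance instInterval {A : Type u} [EffectAlgebra A] (c : A) :
    EffectAlgebra (Interval c) :=
  ofRel (A := Interval c) ⟨zero, c, mem_zero c⟩
    (fun x => ⟨x.2.choose, x.1, mem_comm x.2.choose_spec⟩)
    (fun x y z => z.1 ∈ oplus x.1 y.1)
    (fun _ _ _ _ h h' => Subtype.ext (Part.mem_unique h h'))
    (fun x => mem_zero x.1)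
    (fun _ _ _ h => mem_comm h)
    (fun a b d e f h h' => by
      obtain ⟨t, ht, ht'⟩ := mem_assoc h h'
      obtain ⟨y, hy⟩ := f.2
      obtain ⟨s, hs, hs'⟩ := mem_assoc (mem_comm ht') hy
      exact ⟨⟨t, s, hs'⟩, ht, ht'⟩)
    (fun a b => by
      have h0 : ∀ z, c ∈ oplus zero z → z = c := fun z hz => (eq_of_mem_zero hz).symm
      have h1 := h0 _ (Exists.choose_spec (⟨c, mem_zero c⟩ : ∃ y, c ∈ oplus (zero : A) y))
      constructor
      · intro h
        change Exists.choose (⟨c, mem_zero c⟩ : ∃ y, c ∈ oplus (zero : A) y) ∈ _ at h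
        rw [h1] at h
        exact Subtype.ext (cancel h a.2.choose_spec)
      · rintro rfl
        change Exists.choose (⟨c, mem_zero c⟩ : ∃ y, c ∈ oplus (zero : A) y) ∈ _
        rw [h1]
        exact a.2.choose_spec)
    (fun a e h => by
      have h0 : ∀ z, c ∈ oplus zero z → z = c := fun z hz => (eq_of_mem_zero hz).symm
      have h1 := h0 _ (Exists.choose_spec (⟨c, mem_zero c⟩ : ∃ y, c ∈ oplus (zero : A) y))
      change e.1 ∈ oplus a.1 (Exists.choose (⟨c, mem_zero c⟩ : ∃ y, c ∈ oplus (zero : A) y)) at h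
      rw [h1] at h
      obtain ⟨y, hy⟩ := e.2
      obtain ⟨s, hs, hs'⟩ := mem_assoc (mem_comm h) hy
      have := cancel hs' (mem_comm (mem_zero c))
      subst this
      exact Subtype.ext (eq_zero_of_mem_zero hs))

theorem Interval.mem_iff {A : Type u} [EffectAlgebra A] {c : A} (x y z : Interval c) :
    z ∈ oplus x y ↔ z.1 ∈ oplus x.1 y.1 :=
  mem_relPart (R := fun x y z : Interval c => z.1 ∈ oplus x.1 y.1)
    fun _ _ _ _ h h' => Subtype.ext (Part.mem_unique h h')

theorem Interval.one_val {A : Type u} [EffectAlgebra A] {c : A} :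
    (one : Interval c).1 = c :=
  (eq_of_mem_zero (Exists.choose_spec (⟨c, mem_zero c⟩ : ∃ y, c ∈ oplus (zero : A) y))).symm

/-! ### The tensor product of effect algebras -/

/-- Formal expressions in pure tensors `a ⊗ b`. -/
inductive TensorTerm (A : Type u) (B : Type v) : Type (max u v)
  | zero : TensorTerm A B
  | tmul : A → B → TensorTerm A B
  | oplus : TensorTerm A B → TensorTerm A B → TensorTerm A B
  | compl : TensorTerm A B → TensorTerm A B

section tensor

variable {A : Type u} {B : Type v} [EffectAlgebra A] [EffectAlgebra B]

/-- The (partial) evaluation of an expression under a bilinear morphism. -/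
def TensorTerm.eval {C : Type w} [EffectAlgebra C] (β : Bimorphism A B C) :
    TensorTerm A B → Part C
  | .zero => Part.some EffectAlgebra.zero
  | .tmul a b => Part.some (β.toFun a b)
  | .oplus s t => (s.eval β).bind fun x => (t.eval β).bind fun y => EffectAlgebra.oplus x y
  | .compl t => (t.eval β).map EffectAlgebra.compl

/-- Expressions whose value is defined under every bilinear morphism, identified if they have the
same value under every bilinear morphism. -/
def tensorSetoid (A : Type u) (B : Type v) [EffectAlgebra A] [EffectAlgebra B] :
    Setoid {t : TensorTerm A B // ∀ (C : Type (max u v)) [EffectAlgebra C] (β : Bimorphism A B C),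
      (t.eval β).Dom} where
  r s t := ∀ (C : Type (max u v)) [EffectAlgebra C] (β : Bimorphism A B C),
    s.1.eval β = t.1.eval β
  iseqv := ⟨fun _ _ _ _ => rfl, fun h C _ β => (h C β).symm,
    fun h h' C _ β => (h C β).trans (h' C β)⟩

/-- The tensor product `A ⊗ B` of effect algebras, which represents bilinear morphisms
(see `tmul` and `tensorLift` for the universal bilinear morphism and the universal property). -/
def Tensor (A : Type u) (B : Type v) [EffectAlgebra A] [EffectAlgebra B] : Type (max u v) :=
  Quotient (tensorSetoid A B)

namespace Tensor

/-- The value of an element of `A ⊗ B` under a bilinear morphism. -/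
def val {C : Type (max u v)} [EffectAlgebra C] (β : Bimorphism A B C) : Tensor A B → C :=
  Quotient.lift (fun t => (t.1.eval β).get (t.2 C β)) (fun s t h => by
    have h' : s.1.eval β = t.1.eval β := h C β
    exact Part.get_eq_get_of_eq _ _ h')

theorem val_ext {x y : Tensor A B}
    (h : ∀ (C : Type (max u v)) [EffectAlgebra C] (β : Bimorphism A B C), val β x = val β y) :
    x = y := by
  induction x using Quotient.inductionOn with | _ s
  induction y using Quotient.inductionOn with | _ t
  refine Quotient.sound fun C _ β => ?_
  refine Part.ext' ⟨fun _ => t.2 C β, fun _ => s.2 C β⟩ fun _ _ => h C β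

theorem mem_eval {C : Type (max u v)} [EffectAlgebra C] (β : Bimorphism A B C)
    (t : {t : TensorTerm A B // ∀ (C : Type (max u v)) [EffectAlgebra C] (β : Bimorphism A B C),
      (t.eval β).Dom}) : val β (Quotient.mk _ t) ∈ t.1.eval β :=
  Part.get_mem (t.2 C β)

/-- The zero element. -/
def zero : Tensor A B := Quotient.mk _ ⟨.zero, fun _ _ _ => trivial⟩

/-- The orthocomplement. -/
def compl : Tensor A B → Tensor A B :=
  Quotient.map (fun t => ⟨.compl t.1, fun C _ β => t.2 C β⟩) (fun s t h C _ β => by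
    change (s.1.eval β).map _ = (t.1.eval β).map _
    rw [h C β])

theorem val_zero {C : Type (max u v)} [EffectAlgebra C] (β : Bimorphism A B C) :
    val β zero = EffectAlgebra.zero := rfl

theorem val_compl {C : Type (max u v)} [EffectAlgebra C] (β : Bimorphism A B C)
    (x : Tensor A B) : val β (compl x) = EffectAlgebra.compl (val β x) := by
  induction x using Quotient.inductionOn with | _ t
  rfl

/-- `z = x ⊕ y` holds under every bilinear morphism. -/
def Rel (x y z : Tensor A B) : Prop :=
  ∀ (C : Type (max u v)) [EffectAlgebra C] (β : Bimorphism A B C),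
    val β z ∈ oplus (val β x) (val β y)

theorem exists_rel (x y : Tensor A B)
    (h : ∀ (C : Type (max u v)) [EffectAlgebra C] (β : Bimorphism A B C),
      (oplus (val β x) (val β y)).Dom) : ∃ z, Rel x y z := by
  induction x using Quotient.inductionOn with | _ s
  induction y using Quotient.inductionOn with | _ t
  have key : ∀ (C : Type (max u v)) [EffectAlgebra C] (β : Bimorphism A B C) (c : C),
      c ∈ oplus (val β (Quotient.mk _ s)) (val β (Quotient.mk _ t)) →
      c ∈ (TensorTerm.oplus s.1 t.1).eval β := by
    intro C _ β c hc
    exact Part.mem_bind_iff.2 ⟨_, mem_eval β s, Part.mem_bind_iff.2 ⟨_, mem_eval β t, hc⟩⟩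
  have hd : ∀ (C : Type (max u v)) [EffectAlgebra C] (β : Bimorphism A B C),
      ((TensorTerm.oplus s.1 t.1).eval β).Dom := fun C _ β => (key C β _ (Part.get_mem (h C β))).1
  refine ⟨Quotient.mk _ ⟨.oplus s.1 t.1, hd⟩, ?_⟩
  intro C _ β
  have h1 := Part.get_mem (h C β)
  have h2 := Part.mem_unique (key C β _ h1) (mem_eval β ⟨.oplus s.1 t.1, hd⟩)
  rwa [h2] at h1

noncomputable instance : EffectAlgebra (Tensor A B) :=
  ofRel zero compl Rel
    (fun _ _ _ _ h h' => val_ext fun C _ β => Part.mem_unique (h C β) (h' C β))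
    (fun _ _ _ _ => mem_zero _)
    (fun _ _ _ h C _ β => mem_comm (h C β))
    (fun a b c d e h h' => by
      have : ∃ f, Rel b c f := exists_rel b c fun C _ β => by
        obtain ⟨f, hf, -⟩ := mem_assoc (h C β) (h' C β)
        exact hf.1
      obtain ⟨f, hf⟩ := this
      refine ⟨f, hf, fun C _ β => ?_⟩
      obtain ⟨f', hf', he⟩ := mem_assoc (h C β) (h' C β)
      rwa [Part.mem_unique hf' (hf C β)] at he)
    (fun a b => by
      constructor
      · intro h
        refine val_ext fun C _ β => ?_
        have := h C β
        rw [val_compl, val_zero] at this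
        rw [val_compl]
        exact one_mem_iff.1 this
      · rintro rfl C _ β
        rw [val_compl, val_compl, val_zero]
        exact one_mem _)
    (fun a c h => val_ext fun C _ β => by
      have := h C β
      rw [val_compl, val_zero] at this
      exact (oplus_one_dom_iff _).1 this.1)

theorem mem_iff (x y z : Tensor A B) :
    z ∈ oplus x y ↔ ∀ (C : Type (max u v)) [EffectAlgebra C] (β : Bimorphism A B C),
      val β z ∈ oplus (val β x) (val β y) :=
  mem_relPart (R := Rel) fun _ _ _ _ h h' => val_ext fun C _ β => Part.mem_unique (h C β) (h' C β)

end Tensor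

/-- The universal bilinear morphism `(a, b) ↦ a ⊗ b`. -/
noncomputable def tmul (A : Type u) (B : Type v) [EffectAlgebra A] [EffectAlgebra B] :
    Bimorphism A B (Tensor A B) where
  toFun a b := Quotient.mk _ ⟨.tmul a b, fun _ _ _ => trivial⟩
  zero_left b := Tensor.val_ext fun _ _ β => β.zero_left b
  zero_right a := Tensor.val_ext fun _ _ β => β.zero_right a
  oplus_left a a' a'' b h := (Tensor.mem_iff _ _ _).2 fun _ _ β => β.oplus_left a a' a'' b h
  oplus_right a b b' b'' h := (Tensor.mem_iff _ _ _).2 fun _ _ β => β.oplus_right a b b' b'' h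
  one_one := Tensor.val_ext fun _ _ β => β.one_one

/-- Existence part of the universal property: every bilinear morphism `A × B → C`
extends to a morphism `A ⊗ B → C`. -/
def tensorLift {C : Type (max u v)} [EffectAlgebra C] (β : Bimorphism A B C) :
    Hom (Tensor A B) C where
  toFun := Tensor.val β
  map_zero := Tensor.val_zero β
  map_compl := Tensor.val_compl β
  map_oplus _ _ _ h := (Tensor.mem_iff _ _ _).1 h C β

theorem tensorLift_tmul {C : Type (max u v)} [EffectAlgebra C] (β : Bimorphism A B C)
    (a : A) (b : B) : (tensorLift β).toFun ((tmul A B).toFun a b) = β.toFun a b := rfl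

/-- The element of `A ⊗ B` given by an expression. -/
def Tensor.mk (t : TensorTerm A B) (ht : ∀ (C : Type (max u v)) [EffectAlgebra C]
    (β : Bimorphism A B C), (t.eval β).Dom) : Tensor A B :=
  Quotient.mk _ ⟨t, ht⟩

/-- Uniqueness part of the universal property, for maps that preserve `⊕`. -/
theorem Tensor.funext_of_additive {C : Type w} [EffectAlgebra C] {f g : Tensor A B → C}
    (hf : ∀ a b c, c ∈ oplus a b → f c ∈ oplus (f a) (f b))
    (hg : ∀ a b c, c ∈ oplus a b → g c ∈ oplus (g a) (g b))
    (h : ∀ a b, f ((tmul A B).toFun a b) = g ((tmul A B).toFun a b)) : f = g := by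
  have f0 : f EffectAlgebra.zero = EffectAlgebra.zero :=
    eq_zero_of_mem_left (hf EffectAlgebra.zero EffectAlgebra.zero EffectAlgebra.zero (mem_zero EffectAlgebra.zero))
  have g0 : g EffectAlgebra.zero = EffectAlgebra.zero :=
    eq_zero_of_mem_left (hg EffectAlgebra.zero EffectAlgebra.zero EffectAlgebra.zero (mem_zero EffectAlgebra.zero))
  have h1 : f one = g one := by rw [← (tmul A B).one_one]; exact h _ _
  have key : ∀ (t : TensorTerm A B) (ht : ∀ (C : Type (max u v)) [EffectAlgebra C]
      (β : Bimorphism A B C), (t.eval β).Dom),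
      f (Tensor.mk t ht) = g (Tensor.mk t ht) := by
    intro t
    induction t with
    | zero => intro _; exact f0.trans g0.symm
    | tmul a b => intro _; exact h a b
    | oplus s t ihs iht =>
      intro ht
      have hs' : ∀ (C : Type (max u v)) [EffectAlgebra C]
          (β : Bimorphism A B C), (s.eval β).Dom := by
        intro C _ β
        obtain ⟨c, hc⟩ := Part.dom_iff_mem.1 (ht C β)
        obtain ⟨x, hx, -⟩ := Part.mem_bind_iff.1 hc
        exact hx.1
      have ht' : ∀ (C : Type (max u v)) [EffectAlgebra C]
          (β : Bimorphism A B C), (t.eval β).Dom := by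
        intro C _ β
        obtain ⟨c, hc⟩ := Part.dom_iff_mem.1 (ht C β)
        obtain ⟨x, hx, hc⟩ := Part.mem_bind_iff.1 hc
        obtain ⟨y, hy, -⟩ := Part.mem_bind_iff.1 hc
        exact hy.1
      have hm : (Tensor.mk (.oplus s t) ht) ∈
          EffectAlgebra.oplus (Tensor.mk s hs')
            (Tensor.mk t ht') := by
        refine (Tensor.mem_iff _ _ _).2 fun C _ β => ?_
        obtain ⟨x, hx, hc⟩ := Part.mem_bind_iff.1 (Tensor.mem_eval β ⟨.oplus s t, ht⟩)
        obtain ⟨y, hy, hc⟩ := Part.mem_bind_iff.1 hc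
        rw [Part.mem_unique hx (Tensor.mem_eval β ⟨s, hs'⟩),
          Part.mem_unique hy (Tensor.mem_eval β ⟨t, ht'⟩)] at hc
        exact hc
      have h1 := hf _ _ _ hm
      have h2 := hg _ _ _ hm
      rw [ihs, iht] at h1
      exact Part.mem_unique h1 h2
    | compl t iht =>
      intro ht
      have hm := one_mem (Tensor.mk t ht)
      have e1 := hf _ _ _ hm
      have e2 := hg _ _ _ hm
      rw [h1, iht ht] at e1
      exact cancel e1 e2
  funext x
  induction x using Quotient.inductionOn with | _ t
  exact key t.1 t.2

end tensor

end EffectAlgebra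

open EffectAlgebra

/-! ### Effect modules -/

/-- An effect module: an effect algebra `E` with a bilinear map `[0,1] × E → E` of effect algebras
that is an action of the multiplicative monoid `[0,1]`. -/
class EffectModule (E : Type u) extends EffectAlgebra E where
  action : Bimorphism unitInterval E E
  one_action : ∀ x, action.toFun 1 x = x
  mul_action : ∀ r s x, action.toFun (r * s) x = action.toFun r (action.toFun s x)

/-- The unit interval as an effect module over itself. -/
instance instModuleUnitInterval : EffectModule unitInterval where
  action :=
    { toFun := fun r s => r * s
      zero_left := fun s => zero_mul s
      zero_right := fun r => mul_zero r
      oplus_left := by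
        rintro a a' _ b ⟨h, rfl⟩
        have hb := b.2
        have ha : (a : ℝ) + a' ≤ 1 := h
        exact ⟨by
          change (a : ℝ) * b + a' * b ≤ 1
          nlinarith [hb.1, hb.2, a.2.1, a'.2.1], Subtype.ext (add_mul (a : ℝ) a' b).symm⟩
      oplus_right := by
        rintro b a a' _ ⟨h, rfl⟩
        have hb := b.2
        have ha : (a : ℝ) + a' ≤ 1 := h
        exact ⟨by
          change (b : ℝ) * a + b * a' ≤ 1
          nlinarith [hb.1, hb.2, a.2.1, a'.2.1], Subtype.ext (mul_add (b : ℝ) a a').symm⟩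
      one_one := by
        change unitInterval.symm 0 * unitInterval.symm 0 = unitInterval.symm 0
        simp }
  one_action := fun s => one_mul s
  mul_action := fun r s t => mul_assoc r s t

/-- Powers `E ^ X` of an effect module, with the pointwise structure. -/
instance instModulePi (X : Type v) (E : Type u) [EffectModule E] : EffectModule (X → E) where
  action :=
    { toFun := fun r f x => EffectModule.action.toFun r (f x)
      zero_left := fun f => funext fun x => Bimorphism.zero_left _ (f x)
      zero_right := fun r => funext fun x => Bimorphism.zero_right _ r
      oplus_left := fun a a' a'' f h =>
        ⟨fun x => (Bimorphism.oplus_left EffectModule.action a a' a'' (f x) h).1,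
          funext fun x => (Bimorphism.oplus_left EffectModule.action a a' a'' (f x) h).2⟩
      oplus_right := by
        rintro r f g _ ⟨h, rfl⟩
        exact ⟨fun x => (Bimorphism.oplus_right EffectModule.action r (f x) (g x) _ ⟨h x, rfl⟩).1,
          funext fun x =>
            (Bimorphism.oplus_right EffectModule.action r (f x) (g x) _ ⟨h x, rfl⟩).2⟩
      one_one := funext fun x => Bimorphism.one_one EffectModule.action }
  one_action := fun f => funext fun x => EffectModule.one_action (f x)
  mul_action := fun r s f => funext fun x => EffectModule.mul_action r s (f x)

/-! ### The action of `[0,1]` on `[0,1] ⊗ A` -/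

namespace EffectAlgebra

section scalars

variable (A : Type u) [EffectAlgebra A]

/-- For `r` in `[0,1]`, the bilinear map `(s, a) ↦ rs ⊗ a` into the interval `[0, r ⊗ 1]`. -/
noncomputable def scaleBimorphism (r : unitInterval) :
    Bimorphism unitInterval A (Interval ((tmul unitInterval A).toFun r one)) where
  toFun s a := ⟨(tmul unitInterval A).toFun (r * s) a, by
    have h1 := (tmul unitInterval A).oplus_right (r * s) _ _ _ (one_mem a)
    have h2 := instModuleUnitInterval.action.oplus_right r _ _ _ (one_mem s)
    have h3 := (tmul unitInterval A).oplus_left _ _ _ (one : A) h2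
    have h4 : instModuleUnitInterval.action.toFun r one = r := by
      change r * unitInterval.symm 0 = r
      simp
    rw [h4] at h3
    obtain ⟨f, -, hf⟩ := mem_assoc h1 h3
    exact ⟨f, hf⟩⟩
  zero_left a := Subtype.ext (by
    have : r * (zero : unitInterval) = zero := mul_zero r
    change (tmul unitInterval A).toFun (r * zero) a = zero
    rw [this, (tmul unitInterval A).zero_left])
  zero_right s := Subtype.ext ((tmul unitInterval A).zero_right (r * s))
  oplus_left s s' s'' a h := (Interval.mem_iff _ _ _).2
    ((tmul unitInterval A).oplus_left _ _ _ a
      (instModuleUnitInterval.action.oplus_right r _ _ _ h))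
  oplus_right s a a' a'' h := (Interval.mem_iff _ _ _).2
    ((tmul unitInterval A).oplus_right (r * s) _ _ _ h)
  one_one := Subtype.ext (by
    rw [Interval.one_val]
    change (tmul unitInterval A).toFun (r * unitInterval.symm 0) one = _
    simp)

/-- Multiplication by the scalar `r` on `[0,1] ⊗ A`, determined by `r • (s ⊗ a) = rs ⊗ a`. -/
noncomputable def scale (r : unitInterval) (x : Tensor unitInterval A) : Tensor unitInterval A :=
  ((tensorLift (scaleBimorphism A r)).toFun x).1

variable {A}

theorem scale_tmul (r s : unitInterval) (a : A) :
    scale A r ((tmul unitInterval A).toFun s a) = (tmul unitInterval A).toFun (r * s) a := rfl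

theorem scale_additive (r : unitInterval) (x y z : Tensor unitInterval A) (h : z ∈ oplus x y) :
    scale A r z ∈ oplus (scale A r x) (scale A r y) :=
  (Interval.mem_iff _ _ _).1 ((tensorLift (scaleBimorphism A r)).map_oplus _ _ _ h)

theorem scale_one (x : Tensor unitInterval A) : scale A 1 x = x := by
  refine congrFun (Tensor.funext_of_additive (f := scale A 1) (g := fun x => x)
    (scale_additive 1) (fun _ _ _ h => h) fun r a => ?_) x
  rw [scale_tmul, one_mul]

theorem scale_mul (r s : unitInterval) (x : Tensor unitInterval A) :
    scale A (r * s) x = scale A r (scale A s x) := by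
  refine congrFun (Tensor.funext_of_additive (f := scale A (r * s))
    (g := fun x => scale A r (scale A s x))
    (scale_additive _) (fun _ _ _ h => scale_additive r _ _ _ (scale_additive s _ _ _ h))
    fun t a => ?_) x
  simp only [scale_tmul, mul_assoc]

theorem scale_oplus (r s t : unitInterval) (h : t ∈ oplus r s) (x : Tensor unitInterval A) :
    scale A t x ∈ oplus (scale A r x) (scale A s x) := by
  have hd : ∀ x, (oplus (scale A r x) (scale A s x)).Dom := fun x => by
    obtain ⟨p, hp⟩ := ((tensorLift (scaleBimorphism A r)).toFun x).2
    obtain ⟨q, hq⟩ := ((tensorLift (scaleBimorphism A s)).toFun x).2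
    exact dom_mono hp hq ((tmul unitInterval A).oplus_left _ _ _ one h).1
  choose g hg using fun x => Part.dom_iff_mem.1 (hd x)
  have : scale A t = g := by
    refine Tensor.funext_of_additive (scale_additive t) ?_ ?_
    · intro x y z hz
      exact mem_exchange (scale_additive r _ _ _ hz) (scale_additive s _ _ _ hz) (hg x) (hg y)
        (hg z)
    · intro p a
      refine Part.mem_unique ?_ (hg _)
      simp only [scale_tmul]
      exact (tmul unitInterval A).oplus_left _ _ _ a
        (instModuleUnitInterval.action.oplus_left _ _ _ p h)
  rw [this]
  exact hg x

/-- The effect module `[0,1] ⊗ A`. -/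
noncomputable instance instModuleTensor : EffectModule (Tensor unitInterval A) where
  action :=
    { toFun := scale A
      zero_left := fun x => eq_zero_of_mem_left (scale_oplus _ _ _ (mem_zero (zero : unitInterval)) x)
      zero_right := fun r => eq_zero_of_mem_left (scale_additive r _ _ _ (mem_zero zero))
      oplus_left := fun r s t x h => scale_oplus r s t h x
      oplus_right := fun r x y z h => scale_additive r x y z h
      one_one := by
        have : (one : unitInterval) = 1 := unitInterval.symm_zero
        rw [this, scale_one] }
  one_action := scale_one
  mul_action := scale_mul

end scalars

end EffectAlgebra

/-! ### The categories `EA` and `EMod` -/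

/-- The category of effect algebras. -/
structure EA : Type (u + 1) where
  carrier : Type u
  [str : EffectAlgebra carrier]

attribute [instance] EA.str

/-- Composition of morphisms of effect algebras. -/
def EffectAlgebra.Hom.comp {A : Type u} {B : Type v} {C : Type w} [EffectAlgebra A]
    [EffectAlgebra B] [EffectAlgebra C] (f : Hom A B) (g : Hom B C) : Hom A C where
  toFun a := g.toFun (f.toFun a)
  map_zero := by rw [f.map_zero, g.map_zero]
  map_compl a := by rw [f.map_compl, g.map_compl]
  map_oplus a b c h := g.map_oplus _ _ _ (f.map_oplus _ _ _ h)

instance : Category EA.{u} where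
  Hom A B := Hom A.carrier B.carrier
  id A := ⟨fun a => a, rfl, fun _ => rfl, fun _ _ _ h => h⟩
  comp f g := f.comp g

/-- A morphism of effect modules is a morphism of effect algebras preserving the action. -/
@[ext]
structure EffectModuleHom (E : Type u) (F : Type v) [EffectModule E] [EffectModule F]
    extends Hom E F where
  map_action : ∀ r x,
    toFun (EffectModule.action.toFun r x) = EffectModule.action.toFun r (toFun x)

/-- The category of effect modules. -/
structure EMod : Type (u + 1) where
  carrier : Type u
  [str : EffectModule carrier]

attribute [instance] EMod.str

/-- Composition of morphisms of effect modules. -/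
def EffectModuleHom.comp {E : Type u} {F : Type v} {G : Type w} [EffectModule E]
    [EffectModule F] [EffectModule G] (f : EffectModuleHom E F) (g : EffectModuleHom F G) :
    EffectModuleHom E G where
  toHom := f.toHom.comp g.toHom
  map_action r x := by
    change g.toFun (f.toFun _) = EffectModule.action.toFun r (g.toFun (f.toFun x))
    rw [f.map_action, g.map_action]

instance : Category EMod.{u} where
  Hom E F := EffectModuleHom E.carrier F.carrier
  id A := ⟨⟨fun a => a, rfl, fun _ => rfl, fun _ _ _ h => h⟩, fun _ _ => rfl⟩
  comp f g := f.comp g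

/-- The forgetful functor `EMod ⥤ EA`. -/
def forgetEMod : EMod.{u} ⥤ EA.{u} where
  obj E := ⟨E.carrier⟩
  map f := f.toHom

/-! ### The free effect module functor and the monad `M = [0,1] ⊗ -` -/

namespace FreeEffectModule

/-- The morphism `a ↦ 1 ⊗ a`. -/
noncomputable def unit (A : Type u) [EffectAlgebra A] : Hom A (Tensor unitInterval A) where
  toFun a := (tmul unitInterval A).toFun 1 a
  map_zero := (tmul unitInterval A).zero_right 1
  map_compl a := by
    have h := (tmul unitInterval A).oplus_right 1 _ _ _ (one_mem a)
    have h1 : (one : unitInterval) = 1 := unitInterval.symm_zero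
    have h2 : (tmul unitInterval A).toFun 1 one = one := by
      rw [← h1]; exact (tmul unitInterval A).one_one
    rw [h2] at h
    exact one_mem_iff.1 h
  map_oplus a b c h := (tmul unitInterval A).oplus_right 1 a b c h

/-- The bilinear morphism `(r, a) ↦ r • f a`. -/
def bimorphism {A E : Type u} [EffectAlgebra A] [EffectModule E] (f : Hom A E) :
    Bimorphism unitInterval A E where
  toFun r a := EffectModule.action.toFun r (f.toFun a)
  zero_left a := Bimorphism.zero_left _ _
  zero_right r := by rw [f.map_zero, Bimorphism.zero_right]
  oplus_left r s t a h := Bimorphism.oplus_left EffectModule.action r s t _ h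
  oplus_right r a b c h := Bimorphism.oplus_right EffectModule.action r _ _ _ (f.map_oplus _ _ _ h)
  one_one := by rw [f.map_one, Bimorphism.one_one]

/-- The morphism `[0,1] ⊗ A → E`, `r ⊗ a ↦ r • f a`, of effect modules. -/
def lift {A E : Type u} [EffectAlgebra A] [EffectModule E] (f : Hom A E) :
    EffectModuleHom (Tensor unitInterval A) E where
  toHom := tensorLift (bimorphism f)
  map_action r x := by
    refine congrFun (Tensor.funext_of_additive
      (f := fun x => (tensorLift (bimorphism f)).toFun (scale A r x))
      (g := fun x => EffectModule.action.toFun r ((tensorLift (bimorphism f)).toFun x))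
      (fun _ _ _ h => Hom.map_oplus _ _ _ _ (scale_additive r _ _ _ h))
      (fun _ _ _ h => Bimorphism.oplus_right EffectModule.action r _ _ _
        (Hom.map_oplus _ _ _ _ h)) fun s a => ?_) x
    simp only [scale_tmul, tensorLift_tmul]
    exact EffectModule.mul_action r s _

theorem hom_ext {A E : Type u} [EffectAlgebra A] [EffectModule E]
    {f g : EffectModuleHom (Tensor unitInterval A) E}
    (h : ∀ a, f.toFun ((unit A).toFun a) = g.toFun ((unit A).toFun a)) : f = g := by
  refine EffectModuleHom.ext (Tensor.funext_of_additive f.map_oplus g.map_oplus fun r a => ?_)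
  have : (tmul unitInterval A).toFun r a =
      EffectModule.action.toFun r ((unit A).toFun a) := by
    change _ = (tmul unitInterval A).toFun (r * 1) a
    rw [mul_one]
  rw [this, f.map_action, g.map_action, h]

theorem lift_unit {A E : Type u} [EffectAlgebra A] [EffectModule E] (f : Hom A E) (a : A) :
    (lift f).toFun ((unit A).toFun a) = f.toFun a :=
  EffectModule.one_action _

theorem lift_comp {A E F : Type u} [EffectAlgebra A] [EffectModule E] [EffectModule F]
    (f : Hom A E) (g : EffectModuleHom E F) (h : Hom A F)
    (w : ∀ a, g.toFun (f.toFun a) = h.toFun a) : lift h = (lift f).comp g := by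
  refine hom_ext fun a => ?_
  change _ = g.toFun ((lift f).toFun ((unit A).toFun a))
  rw [lift_unit, lift_unit, w]

end FreeEffectModule

/-- The functor `A ↦ [0,1] ⊗ A` from effect algebras to effect modules; it sends `f` to
`r ⊗ a ↦ r ⊗ f a`. -/
noncomputable def freeEMod : EA.{u} ⥤ EMod.{u} where
  obj A := ⟨Tensor unitInterval A.carrier⟩
  map f := FreeEffectModule.lift (f.comp (FreeEffectModule.unit _))
  map_id A := FreeEffectModule.hom_ext fun a => FreeEffectModule.lift_unit _ a
  map_comp {A B C} f g := FreeEffectModule.lift_comp (f.comp (FreeEffectModule.unit _)) _ _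
    fun a => by
      change (FreeEffectModule.lift _).toFun ((FreeEffectModule.unit B.carrier).toFun _) = _
      exact FreeEffectModule.lift_unit _ _

/-- The functor `A ↦ [0,1] ⊗ A` is left adjoint to the forgetful functor; the unit is
`a ↦ 1 ⊗ a`. -/
noncomputable def freeForgetAdj : freeEMod.{u} ⊣ forgetEMod.{u} :=
  Adjunction.mkOfHomEquiv
    { homEquiv := fun A E =>
        { toFun := fun h =>
            (show A ⟶ forgetEMod.obj (freeEMod.obj A) from FreeEffectModule.unit A.carrier) ≫
              forgetEMod.map h
          invFun := fun f => FreeEffectModule.lift (E := E.carrier) f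
          left_inv := fun h => FreeEffectModule.hom_ext fun a =>
            FreeEffectModule.lift_unit (E := E.carrier) _ a
          right_inv := fun f => Hom.ext (funext fun a =>
            FreeEffectModule.lift_unit (E := E.carrier) f a) }
      homEquiv_naturality_left_symm := fun {A B E} f g =>
        FreeEffectModule.lift_comp (E := Tensor unitInterval B.carrier) (F := E.carrier)
          (f.comp (FreeEffectModule.unit _)) (FreeEffectModule.lift (E := E.carrier) g) _
          fun a => FreeEffectModule.lift_unit (E := E.carrier) g (f.toFun a)
      homEquiv_naturality_right := fun f g => rfl }

theorem kleisliComparison_aux {C : Type*} {D : Type*} [Category C] [Category D] {L : C ⥤ D}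
    {R : D ⥤ C} (adj : L ⊣ R) {X Y Z : C} (f : X ⟶ R.obj (L.obj Y)) (g : Y ⟶ R.obj (L.obj Z)) :
    L.map (f ≫ R.map (L.map g) ≫ R.map (adj.counit.app (L.obj Z))) ≫ adj.counit.app (L.obj Z) =
      (L.map f ≫ adj.counit.app (L.obj Y)) ≫ L.map g ≫ adj.counit.app (L.obj Z) := by
  simp

/-- The canonical functor from the Kleisli category of the monad `R L` of an adjunction `L ⊣ R`,
with `L : C ⥤ D`, to the category `D`: it sends `X` to `L X`, and a Kleisli morphism
`X ⟶ R (L Y)` to its transpose `L X ⟶ L Y`. -/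
def kleisliComparison {C : Type*} {D : Type*} [Category C] [Category D] {L : C ⥤ D} {R : D ⥤ C}
    (adj : L ⊣ R) : Kleisli adj.toMonad ⥤ D where
  obj X := L.obj X.of
  map {X Y} f := L.map f.of ≫ adj.counit.app (L.obj Y.of)
  map_id X := adj.left_triangle_components X.of
  map_comp f g := kleisliComparison_aux adj f.of g.of

/-- The monad `M = [0,1] ⊗ -` on effect algebras. -/
noncomputable abbrev monadM : Monad EA.{u} := freeForgetAdj.{u}.toMonad

/-- A finite Boolean algebra, as an object of the Kleisli category of `M`. -/
def FinBoolAlg.toKleisli (B : FinBoolAlg.{u}) : Kleisli monadM.{u} :=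
  Kleisli.mk monadM { carrier := B, str := ofBooleanAlgebra B }

/-- The full subcategory of the Kleisli category of `M` on finite Boolean algebras. -/
abbrev KleisliFinBoolAlg : Type (u + 1) :=
  InducedCategory (Kleisli monadM.{u}) FinBoolAlg.toKleisli.{u}

/-- The inclusion of the full subcategory of the Kleisli category of `M` on finite Boolean
algebras into the category of effect modules. -/
noncomputable def inclusionM : KleisliFinBoolAlg.{u} ⥤ EMod.{u} :=
  inducedFunctor FinBoolAlg.toKleisli ⋙ kleisliComparison freeForgetAdj

/-- The finite Boolean algebra `2 ^ X` of subsets of a finite set `X`. -/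
noncomputable def powersetAlg (X : Type u) [Fintype X] : KleisliFinBoolAlg.{u} :=
  FinBoolAlg.of (Set X)

/-- The effect module `[0,1] ^ X`. -/
def cubeEMod (X : Type u) : EMod.{u} := ⟨X → unitInterval⟩

/-- The element `1 ⊗ S` of `[0,1] ⊗ 2 ^ X`, for a subset `S` of `X`. -/
noncomputable def oneTensor (X : Type u) [Fintype X] (S : Set X) :
    (inclusionM.obj (powersetAlg X)).carrier :=
  letI := ofBooleanAlgebra (Set X)
  (tmul unitInterval (Set X)).toFun 1 S
/-!
Call a finite family with sum `1` in an effect algebra a test. For finite `X`, morphisms `2 ^ X → A`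
of effect algebras correspond to tests indexed by `X` in `A`, via the values on singletons, and
so do morphisms `[0,1] ^ X → E` of effect modules to tests in `E`, via the values on the `χ_{x}`:
a test `e` gives `r ↦ ⨁ r x • e x`. Hence `[0,1] ⊗ 2 ^ X` and `[0,1] ^ X` have the same universal
property. Full faithfulness is transposition along the adjunction.

For density, an element `e` of `E` amounts to the test `(eᗮ, e)`, that is, to a morphism
`[0,1] ^ 2 → E`, and a sum `a ⊕ b = d` amounts to the test `(dᗮ, a, b)`, that is, to a morphism
`[0,1] ^ 3 → E`. So a compatible family of maps on the morphisms from cubes to `E` is given by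
a unique map on `E`, and this map preserves `⊕`.
-/

namespace EffectAlgebra

theorem mem_oplus_pi_iff {X : Type v} {A : Type u} [EffectAlgebra A] {f g h : X → A} :
    h ∈ oplus f g ↔ ∀ x, h x ∈ oplus (f x) (g x) :=
  ⟨by rintro ⟨hd, rfl⟩ x; exact ⟨hd x, rfl⟩,
    fun H => ⟨fun x => (H x).1, funext fun x => (H x).2⟩⟩

/-- The elements of `A` together with `Part.none`, the undefined element. The partial operation
of an effect algebra becomes total here, so that finite sums `∑ i ∈ s, of (f i)` make sense;
the equation `∑ i ∈ s, of (f i) = of a` says that the sum is defined in `A` and equal to `a`. -/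
def Totalization (A : Type u) : Type u := Part A

namespace Totalization

variable {A : Type u}

/-- The embedding of the elements of `A` as the defined elements of its totalization. -/
def of (a : A) : Totalization A := Part.some a

theorem of_injective : Function.Injective (of : A → Totalization A) := Part.some_injective

variable [EffectAlgebra A]

instance : Add (Totalization A) := ⟨fun x y => Part.bind x fun a => Part.bind y (oplus a)⟩

instance : Zero (Totalization A) := ⟨of zero⟩

theorem of_zero : of (zero : A) = 0 := rfl

theorem add_eq_of_iff {x y : Totalization A} {c : A} :
    x + y = of c ↔ ∃ a b, x = of a ∧ y = of b ∧ c ∈ oplus a b := by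
  refine Part.eq_some_iff.trans ⟨fun h => ?_, ?_⟩
  · obtain ⟨a, ha, h⟩ := Part.mem_bind_iff.1 h
    obtain ⟨b, hb, h⟩ := Part.mem_bind_iff.1 h
    exact ⟨a, b, Part.eq_some_iff.2 ha, Part.eq_some_iff.2 hb, h⟩
  · rintro ⟨a, b, rfl, rfl, h⟩
    exact Part.mem_bind_iff.2 ⟨a, Part.mem_some a, Part.mem_bind_iff.2 ⟨b, Part.mem_some b, h⟩⟩

theorem ext_of {A : Type u} {x y : Totalization A} (h : ∀ a, x = of a ↔ y = of a) : x = y :=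
  Part.ext fun a => Part.eq_some_iff.symm.trans ((h a).trans Part.eq_some_iff)

protected theorem add_comm (x y : Totalization A) : x + y = y + x := ext_of fun _ => by
  simp only [add_eq_of_iff]
  exact ⟨fun ⟨a, b, ha, hb, h⟩ => ⟨b, a, hb, ha, mem_comm h⟩,
    fun ⟨b, a, hb, ha, h⟩ => ⟨a, b, ha, hb, mem_comm h⟩⟩

protected theorem zero_add (x : Totalization A) : 0 + x = x := ext_of fun c => by
  refine add_eq_of_iff.trans ⟨?_, fun h => ⟨zero, c, rfl, h, mem_zero c⟩⟩
  rintro ⟨a, b, ha, rfl, h⟩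
  rw [← of_injective ha] at h
  rw [eq_of_mem_zero h]

protected theorem add_assoc (x y z : Totalization A) : x + y + z = x + (y + z) :=
    ext_of fun t => by
  simp only [add_eq_of_iff]
  constructor
  · rintro ⟨d, c, ⟨a, b, ha, hb, hd⟩, hc, ht⟩
    obtain ⟨f, hf, ht⟩ := mem_assoc hd ht
    exact ⟨a, f, ha, ⟨b, c, hb, hc, hf⟩, ht⟩
  · rintro ⟨a, f, ha, ⟨b, c, hb, hc, hf⟩, ht⟩
    obtain ⟨d, hd, ht⟩ := mem_assoc' hf ht
    exact ⟨d, c, ⟨a, b, ha, hb, hd⟩, hc, ht⟩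

instance : AddCommMonoid (Totalization A) where
  nsmul := nsmulRec
  add_assoc := Totalization.add_assoc
  zero_add := Totalization.zero_add
  add_zero x := (Totalization.add_comm x 0).trans (Totalization.zero_add x)
  add_comm := Totalization.add_comm

theorem of_add_of_eq_of_iff {a b c : A} : of a + of b = of c ↔ c ∈ oplus a b := by
  simp only [add_eq_of_iff, of_injective.eq_iff, exists_and_left, exists_eq_left']

variable {ι : Type*} {s : Finset ι}

theorem sum_of_comp {B : Type v} [EffectAlgebra B] {g : A → B}
    (hg : ∀ a b c, c ∈ oplus a b → g c ∈ oplus (g a) (g b)) {f : ι → A} {a : A}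
    (h : ∑ i ∈ s, of (f i) = of a) : ∑ i ∈ s, of (g (f i)) = of (g a) := by
  classical
  induction s using Finset.induction_on generalizing a with
  | empty =>
    have g_zero : g zero = zero := eq_zero_of_mem_left (hg _ _ _ (mem_zero zero))
    rw [← of_injective h, Finset.sum_empty, g_zero, of_zero]
  | insert i s hi ih =>
    rw [Finset.sum_insert hi] at h ⊢
    obtain ⟨b, c, hb, hc, ha⟩ := add_eq_of_iff.1 h
    rw [ih hc, of_add_of_eq_of_iff, of_injective hb]
    exact hg _ _ _ ha

theorem sum_of_pi {X : Type v} {f : ι → X → A} {g : X → A}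
    (h : ∀ x, ∑ i ∈ s, of (f i x) = of (g x)) : ∑ i ∈ s, of (f i) = of g := by
  classical
  induction s using Finset.induction_on generalizing g with
  | empty => exact congrArg of (funext fun x => of_injective (h x))
  | insert i s hi ih =>
    simp only [Finset.sum_insert hi, add_eq_of_iff] at h
    choose a b ha hb hab using h
    rw [Finset.sum_insert hi, ih hb, of_add_of_eq_of_iff, mem_oplus_pi_iff]
    exact fun x => of_injective (ha x) ▸ hab x

end Totalization

open Totalization

section test

variable {X : Type*} [Fintype X] {A : Type u} [EffectAlgebra A]

/-- A test in an effect algebra: a finite family `e` whose sum is defined and equal to `1`. -/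
def IsTest (e : X → A) : Prop := ∑ x, of (e x) = of one

theorem IsTest.map {B : Type v} [EffectAlgebra B] {e : X → A} (he : IsTest e) (f : Hom A B) :
    IsTest fun x => f.toFun (e x) :=
  (sum_of_comp f.map_oplus he).trans (congrArg of f.map_one)

theorem isTest_option_elim {a : X → A} {d : A} (h : ∑ x, of (a x) = of d) :
    IsTest fun x : Option X => x.elim (compl d) a := by
  rw [IsTest, Fintype.sum_option]
  exact (congrArg (of (compl d) + ·) h).trans (of_add_of_eq_of_iff.2 (mem_comm (one_mem d)))

end test

section cube

variable {X : Type v} {E : Type u} [EffectModule E]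

theorem one_eq_one_unitInterval : (one : unitInterval) = 1 := unitInterval.symm_zero

variable [Fintype X]

theorem sum_of_action_add {r s t : X → unitInterval} (h : t ∈ oplus r s) (e : X → E) :
    ∑ x, of (EffectModule.action.toFun (r x) (e x)) +
        ∑ x, of (EffectModule.action.toFun (s x) (e x)) =
      ∑ x, of (EffectModule.action.toFun (t x) (e x)) := by
  rw [← Finset.sum_add_distrib]
  exact Finset.sum_congr rfl fun x _ => of_add_of_eq_of_iff.2 <|
    EffectModule.action.oplus_left _ _ _ _ (mem_oplus_pi_iff.1 h x)

theorem sum_of_action_compl (r : X → unitInterval) (e : X → E) :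
    ∑ x, of (EffectModule.action.toFun (r x) (e x)) +
        ∑ x, of (EffectModule.action.toFun (compl r x) (e x)) =
      ∑ x, of (e x) := by
  rw [sum_of_action_add (one_mem r)]
  refine Finset.sum_congr rfl fun x _ => congrArg of ?_
  change EffectModule.action.toFun (one : unitInterval) (e x) = e x
  rw [one_eq_one_unitInterval, EffectModule.one_action]

namespace IsTest

variable {e : X → E} (he : IsTest e)
include he

theorem exists_sum_of_action_eq (r : X → unitInterval) :
    ∃ a, ∑ x, of (EffectModule.action.toFun (r x) (e x)) = of a := by
  obtain ⟨a, _, ha, -⟩ := add_eq_of_iff.1 ((sum_of_action_compl r e).trans he)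
  exact ⟨a, ha⟩

/-- The combination `⨁ r x • e x` of the members of a test `e`. -/
noncomputable def combination (r : X → unitInterval) : E := (he.exists_sum_of_action_eq r).choose

theorem of_combination (r : X → unitInterval) :
    of (he.combination r) = ∑ x, of (EffectModule.action.toFun (r x) (e x)) :=
  (he.exists_sum_of_action_eq r).choose_spec.symm

/-- The morphism `[0,1] ^ X → E` of effect modules that sends the characteristic function of `{x}`
to `e x`, for a test `e` in `E`. -/
noncomputable def cubeHom : EffectModuleHom (X → unitInterval) E where
  toFun := he.combination
  map_zero := of_injective <| (he.of_combination zero).trans <|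
    Finset.sum_eq_zero fun x _ => congrArg of (EffectModule.action.zero_left (e x))
  map_compl r := one_mem_iff.1 <| of_add_of_eq_of_iff.1 <| by
    rw [of_combination, of_combination, sum_of_action_compl, he]
  map_oplus r s t h := of_add_of_eq_of_iff.1 <| by
    simp only [of_combination, sum_of_action_add h]
  map_action r s := of_injective <| by
    rw [of_combination,
      ← sum_of_comp (EffectModule.action.oplus_right r) (he.of_combination s).symm]
    exact Finset.sum_congr rfl fun x _ => congrArg of (EffectModule.mul_action r (s x) (e x))

theorem cubeHom_indicator_singleton (x : X) :
    he.cubeHom.toFun (({x} : Set X).indicator fun _ => 1) = e x := by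
  refine of_injective ((he.of_combination _).trans ?_)
  rw [Finset.sum_eq_single x]
  · rw [Set.indicator_of_mem (Set.mem_singleton _), EffectModule.one_action]
  · intro y _ hy
    rw [Set.indicator_of_notMem (Set.mem_singleton_iff.not.2 hy)]
    exact congrArg of (EffectModule.action.zero_left (e y))
  · exact fun hx => (hx (Finset.mem_univ x)).elim

end IsTest

theorem sum_of_action_indicator_singleton (r : X → unitInterval) :
    ∑ x, of (EffectModule.action.toFun (r x)
      (({x} : Set X).indicator fun _ => 1 : X → unitInterval)) = of r := by
  refine sum_of_pi fun y => ?_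
  change ∑ x, of (r x * ({x} : Set X).indicator (fun _ => 1) y) = of (r y)
  rw [Finset.sum_eq_single y]
  · rw [Set.indicator_of_mem (Set.mem_singleton _), mul_one]
  · intro x _ hx
    rw [Set.indicator_of_notMem (Set.mem_singleton_iff.not.2 hx.symm), mul_zero]
    rfl
  · exact fun hy => (hy (Finset.mem_univ y)).elim

omit [Fintype X] in
theorem cube_hom_ext [Finite X] {f g : EffectModuleHom (X → unitInterval) E}
    (h : ∀ x, f.toFun (({x} : Set X).indicator fun _ => 1) =
      g.toFun (({x} : Set X).indicator fun _ => 1)) : f = g := by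
  have := Fintype.ofFinite X
  refine EffectModuleHom.ext (funext fun r => of_injective ?_)
  rw [← sum_of_comp f.map_oplus (sum_of_action_indicator_singleton r),
    ← sum_of_comp g.map_oplus (sum_of_action_indicator_singleton r)]
  simp only [f.map_action, g.map_action, h]

end cube

section powerset

attribute [local instance] ofBooleanAlgebra

variable {X : Type u}

theorem sum_of_singleton (s : Finset X) : ∑ x ∈ s, of ({x} : Set X) = of (s : Set X) := by
  classical
  induction s using Finset.induction_on with
  | empty => rw [Finset.coe_empty]; rfl
  | insert x s hx ih =>
    rw [Finset.sum_insert hx, ih, of_add_of_eq_of_iff, Finset.coe_insert]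
    exact ⟨Set.singleton_inter_eq_empty.2 hx, rfl⟩

theorem isTest_singleton [Fintype X] : IsTest fun x : X => ({x} : Set X) := by
  rw [IsTest, sum_of_singleton, Finset.coe_univ]
  exact congrArg of compl_bot.symm

theorem powerset_hom_ext [Finite X] {A : Type v} [EffectAlgebra A] {f g : Hom (Set X) A}
    (h : ∀ x, f.toFun {x} = g.toFun {x}) : f = g := by
  refine Hom.ext (funext fun S => of_injective ?_)
  lift S to Finset X using S.toFinite
  rw [← sum_of_comp f.map_oplus (sum_of_singleton S),
    ← sum_of_comp g.map_oplus (sum_of_singleton S)]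
  simp only [h]

theorem tensorPowerset_hom_ext [Finite X] {E : Type u} [EffectModule E]
    {f g : EffectModuleHom (Tensor unitInterval (Set X)) E}
    (h : ∀ x, f.toFun ((FreeEffectModule.unit (Set X)).toFun {x}) =
      g.toFun ((FreeEffectModule.unit (Set X)).toFun {x})) : f = g := by
  have restrict_eq : (FreeEffectModule.unit (Set X)).comp f.toHom =
      (FreeEffectModule.unit (Set X)).comp g.toHom := powerset_hom_ext h
  exact FreeEffectModule.hom_ext fun S => congrArg (fun k => k.toFun S) restrict_eq

/-- The characteristic functions, as a morphism `2 ^ X → [0,1] ^ X` of effect algebras. -/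
noncomputable def indicatorHom (X : Type u) : Hom (Set X) (X → unitInterval) where
  toFun S := S.indicator fun _ => 1
  map_zero := Set.indicator_empty _
  map_compl S := funext fun x => by
    change Sᶜ.indicator (fun _ => (1 : unitInterval)) x =
      unitInterval.symm (S.indicator (fun _ => 1) x)
    by_cases hx : x ∈ S <;> simp [hx]
  map_oplus := by
    rintro S T _ ⟨hST, rfl⟩
    refine mem_oplus_pi_iff.2 fun x => ?_
    change (S ∪ T).indicator (fun _ => (1 : unitInterval)) x ∈ _
    by_cases hS : x ∈ S
    · have hT : x ∉ T := (Set.disjoint_iff_inter_eq_empty.2 hST).notMem_of_mem_left hS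
      rw [Set.indicator_of_mem hS, Set.indicator_of_notMem hT,
        Set.indicator_of_mem (Set.mem_union_left T hS)]
      exact mem_comm (mem_zero _)
    · rw [Set.indicator_of_notMem hS]
      have union_eq : (S ∪ T).indicator (fun _ => (1 : unitInterval)) x =
          T.indicator (fun _ => 1) x :=
        Set.indicator_eq_indicator (or_iff_right hS) rfl
      rw [union_eq]
      exact mem_zero _

/-- The morphism `[0,1] ⊗ 2 ^ X → [0,1] ^ X`, `r ⊗ S ↦ r • χ_S`, of effect modules. -/
noncomputable def tensorPowersetToCube (X : Type u) :
    EffectModuleHom (Tensor unitInterval (Set X)) (X → unitInterval) :=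
  FreeEffectModule.lift (indicatorHom X)

theorem tensorPowersetToCube_unit (S : Set X) :
    (tensorPowersetToCube X).toFun ((FreeEffectModule.unit (Set X)).toFun S) =
      S.indicator fun _ => 1 :=
  FreeEffectModule.lift_unit (indicatorHom X) S

/-- The morphism `[0,1] ^ X → [0,1] ⊗ 2 ^ X`, `r ↦ ⨁ r x ⊗ {x}`, of effect modules. -/
noncomputable def cubeToTensorPowerset (X : Type u) [Fintype X] :
    EffectModuleHom (X → unitInterval) (Tensor unitInterval (Set X)) :=
  (isTest_singleton.map (FreeEffectModule.unit (Set X))).cubeHom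

theorem cubeToTensorPowerset_indicator_singleton [Fintype X] (x : X) :
    (cubeToTensorPowerset X).toFun (({x} : Set X).indicator fun _ => 1) =
      (FreeEffectModule.unit (Set X)).toFun {x} :=
  IsTest.cubeHom_indicator_singleton _ x

end powerset

end EffectAlgebra

/-- The isomorphism `[0,1] ⊗ 2 ^ X ≅ [0,1] ^ X` of effect modules. -/
noncomputable def cubeIso (X : Type u) [Fintype X] :
    inclusionM.obj (powersetAlg X) ≅ cubeEMod X where
  hom := tensorPowersetToCube X
  inv := cubeToTensorPowerset X
  hom_inv_id := tensorPowerset_hom_ext fun x => by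
    change (cubeToTensorPowerset X).toFun ((tensorPowersetToCube X).toFun _) = _
    rw [tensorPowersetToCube_unit]
    exact cubeToTensorPowerset_indicator_singleton x
  inv_hom_id := cube_hom_ext fun x => by
    change (tensorPowersetToCube X).toFun ((cubeToTensorPowerset X).toFun _) = _
    rw [cubeToTensorPowerset_indicator_singleton]
    exact tensorPowersetToCube_unit {x}

theorem kleisliComparison_map {C : Type*} {D : Type*} [Category C] [Category D] {L : C ⥤ D}
    {R : D ⥤ C} (adj : L ⊣ R) {X Y : Kleisli adj.toMonad} (f : X ⟶ Y) :
    (kleisliComparison adj).map f = (adj.homEquiv X.of (L.obj Y.of)).symm f.of :=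
  (adj.homEquiv_counit _ _ _).symm

/-- The comparison functor of an adjunction `L ⊣ R` is fully faithful, as it transposes Kleisli
morphisms `X ⟶ R (L Y)` to morphisms `L X ⟶ L Y`. -/
def kleisliComparisonFullyFaithful {C : Type*} {D : Type*} [Category C] [Category D] {L : C ⥤ D}
    {R : D ⥤ C} (adj : L ⊣ R) : (kleisliComparison adj).FullyFaithful where
  preimage {X Y} g := .mk (adj.homEquiv X.of (L.obj Y.of) g)
  map_preimage g := (kleisliComparison_map adj _).trans (Equiv.symm_apply_apply _ g)
  preimage_map {X Y} f := Kleisli.hom_ext <|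
    (congrArg (adj.homEquiv X.of (L.obj Y.of)) (kleisliComparison_map adj f)).trans
      (Equiv.apply_symm_apply _ f.of)

/-- The inclusion of the Kleisli category of finite Boolean algebras into `EMod` is fully
faithful. -/
noncomputable def inclusionMFullyFaithful : inclusionM.{u}.FullyFaithful :=
  (fullyFaithfulInducedFunctor _).comp (kleisliComparisonFullyFaithful freeForgetAdj)

section coconeLeg

variable {D : Type*} [Category D] {P : ObjectProperty D} {E : D}
  (s : Limits.Cocone (CostructuredArrow.proj P.ι E ⋙ P.ι))

/-- The leg at `f : Q ⟶ E` of a cocone on the canonical diagram of `E` with respect to the full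
subcategory given by `P`. -/
def coconeLeg {Q : D} (hQ : P Q) (f : Q ⟶ E) : Q ⟶ s.pt :=
  s.ι.app (CostructuredArrow.mk (Y := (⟨Q, hQ⟩ : P.FullSubcategory)) (S := P.ι) f)

theorem comp_coconeLeg {Q Q' : D} (hQ : P Q) (hQ' : P Q') (t : Q' ⟶ Q) (f : Q ⟶ E) :
    t ≫ coconeLeg s hQ f = coconeLeg s hQ' (t ≫ f) :=
  s.w (CostructuredArrow.homMk (P.homMk t) rfl :
    CostructuredArrow.mk (Y := (⟨Q', hQ'⟩ : P.FullSubcategory)) (S := P.ι) (t ≫ f) ⟶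
      CostructuredArrow.mk (Y := (⟨Q, hQ⟩ : P.FullSubcategory)) (S := P.ι) f)

end coconeLeg

section elementHom

open EffectAlgebra.Totalization

variable {E F : EMod.{u}}

theorem exists_cubeEMod_hom_of_mem_oplus {a b d : E.carrier} (h : d ∈ oplus a b) :
    ∃ (X : Type u) (_ : Finite X) (f : cubeEMod X ⟶ E) (p q r : (cubeEMod X).carrier),
      r ∈ oplus p q ∧ f.toFun p = a ∧ f.toFun q = b ∧ f.toFun r = d := by
  let := ofBooleanAlgebra (Set (Option (Option PUnit.{u + 1})))
  have sum_eq : ∑ x : Option PUnit.{u + 1}, of (x.elim a fun _ => b) = of d := by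
    rw [Fintype.sum_option, Fintype.sum_unique]
    exact of_add_of_eq_of_iff.2 h
  let f := (isTest_option_elim sum_eq).cubeHom
  have f_left : f.toFun ((indicatorHom _).toFun {some none}) = a :=
    IsTest.cubeHom_indicator_singleton _ _
  have f_right : f.toFun ((indicatorHom _).toFun {some (some default)}) = b :=
    IsTest.cubeHom_indicator_singleton _ _
  have indicator_mem := (indicatorHom (Option (Option PUnit.{u + 1}))).map_oplus
    {some none} {some (some default)} _ ⟨Set.singleton_inter_eq_empty.2 (by simp), rfl⟩
  have image_mem := f.map_oplus _ _ _ indicator_mem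
  rw [f_left, f_right] at image_mem
  exact ⟨_, inferInstance, f, _, _, _, indicator_mem, f_left, f_right, Part.mem_unique image_mem h⟩

/-- The element `χ_{∗}` of `[0,1] ^ {∗, none}`, where `∗` is `some default`. It is generic:
morphisms from this cube to `E` correspond to elements of `E`, by evaluation at `χ_{∗}`. -/
noncomputable def genericElement : (cubeEMod (Option PUnit.{u + 1})).carrier :=
  ({some default} : Set (Option PUnit)).indicator fun _ => 1

/-- The morphism that sends the generic element to `e`. -/
noncomputable def elementHom (e : E.carrier) : cubeEMod (Option PUnit.{u + 1}) ⟶ E :=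
  (isTest_option_elim (Fintype.sum_unique fun _ : PUnit => of e)).cubeHom

theorem elementHom_genericElement (e : E.carrier) : (elementHom e).toFun genericElement = e :=
  IsTest.cubeHom_indicator_singleton _ _

theorem elementHom_comp (e : E.carrier) (f : E ⟶ F) :
    elementHom e ≫ f = elementHom (f.toFun e) := by
  refine cube_hom_ext fun x => ?_
  change f.toFun ((elementHom e).toFun _) = _
  simp only [elementHom, IsTest.cubeHom_indicator_singleton]
  cases x with
  | none => exact f.map_compl e
  | some _ => rfl

end elementHom

section dense

variable {P : ObjectProperty EMod.{u}} (hP : ∀ (X : Type u) [Finite X], P (cubeEMod X))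
  {E : EMod.{u}} (s : Limits.Cocone (CostructuredArrow.proj P.ι E ⋙ P.ι))

/-- The map underlying the morphism from `E` to the vertex of a cocone on its canonical diagram. -/
noncomputable def coconeDescFun (e : E.carrier) : s.pt.carrier :=
  (coconeLeg s (hP (Option PUnit)) (elementHom e)).toFun genericElement

theorem coconeDescFun_apply {Q : EMod.{u}} (hQ : P Q) (f : Q ⟶ E) (q : Q.carrier) :
    coconeDescFun hP s (f.toFun q) = (coconeLeg s hQ f).toFun q := by
  rw [coconeDescFun, ← elementHom_comp, ← comp_coconeLeg s hQ]
  exact congrArg (coconeLeg s hQ f).toFun (elementHom_genericElement q)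

/-- The morphism from `E` to the vertex of a cocone on its canonical diagram. -/
noncomputable def coconeDesc : E ⟶ s.pt where
  toFun := coconeDescFun hP s
  map_zero := by
    rw [← (elementHom (zero : E.carrier)).map_zero, coconeDescFun_apply hP s (hP _)]
    exact (coconeLeg s _ _).map_zero
  map_compl e := by
    rw [← elementHom_genericElement e, ← (elementHom e).map_compl,
      coconeDescFun_apply hP s (hP _), coconeDescFun_apply hP s (hP _)]
    exact (coconeLeg s _ _).map_compl _
  map_oplus a b d h := by
    obtain ⟨X, _, f, p, q, r, hr, rfl, rfl, rfl⟩ := exists_cubeEMod_hom_of_mem_oplus h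
    simp only [coconeDescFun_apply hP s (hP X)]
    exact (coconeLeg s _ f).map_oplus _ _ _ hr
  map_action r e := by
    rw [← elementHom_genericElement e, ← (elementHom e).map_action,
      coconeDescFun_apply hP s (hP _), coconeDescFun_apply hP s (hP _)]
    exact (coconeLeg s _ _).map_action _ _

include hP in
theorem isDense_ι_of_cubeEMod : P.ι.IsDense where
  isDenseAt E := ⟨(Functor.denseAtEquiv _ E).symm
    { desc := coconeDesc hP
      fac := fun s j => EffectModuleHom.ext <| funext <|
        coconeDescFun_apply hP s j.left.property j.hom
      uniq := fun s m hm => EffectModuleHom.ext <| funext fun e => by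
        have leg_eq := hm (CostructuredArrow.mk
          (Y := (⟨_, hP (Option PUnit)⟩ : P.FullSubcategory)) (S := P.ι) (elementHom e))
        rw [← elementHom_genericElement e]
        exact (congrArg (fun f => f.toFun genericElement) leg_eq).trans
          (coconeDescFun_apply hP s (hP _) (elementHom e) genericElement).symm }⟩

theorem isDense_of_essImage_cubeEMod {C : Type*} [Category C] (I : C ⥤ EMod.{u}) [I.Full]
    [I.Faithful] (hI : ∀ (X : Type u) [Finite X], I.essImage (cubeEMod X)) : I.IsDense := by
  have := isDense_ι_of_cubeEMod hI
  exact .of_iso I.toEssImageCompι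

end dense

theorem proposition6p2 :
    inclusionM.{u}.IsDense ∧ inclusionM.{u}.Full ∧ inclusionM.{u}.Faithful ∧
      ∀ (X : Type u) [Fintype X],
        ∃ φ : inclusionM.obj (powersetAlg X) ≅ cubeEMod X,
          ∀ S : Set X, φ.hom.toFun (oneTensor X S) = S.indicator (fun _ => (1 : unitInterval)) := by
  have full : inclusionM.{u}.Full := inclusionMFullyFaithful.full
  have faithful : inclusionM.{u}.Faithful := inclusionMFullyFaithful.faithful
  have cube_mem_essImage (X : Type u) [Finite X] : inclusionM.essImage (cubeEMod X) := by
    have := Fintype.ofFinite X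
    exact ⟨powersetAlg X, ⟨cubeIso X⟩⟩
  exact ⟨isDense_of_essImage_cubeEMod inclusionM cube_mem_essImage, full, faithful,
    fun X _ => ⟨cubeIso X, tensorPowersetToCube_unit⟩⟩
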